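/- Let $n\ge 1$ and $m_1,\dots,m_n\in\mathbb{N}_0$, and put $M=m_1+\cdots+m_n$. Consider $\mathbb{C}\mathbb{Z}_2$-gauge theory on the open line $A_{n+1}$ with $n$ edges and, if $n\ge 2$, on the circle $\mathbb{Z}_n$ with $n$ edges. A connection assigns to the two arrows of the $i$-th edge complex numbers $u_{i\to i+1}$ and $u_{i+1\to i}=\overline{u_{i\to i+1}}$, and its Wilson loop variables are $w_i=u_{i\to i+1}u_{i+1\to i}$. The Yang--Mills actions with coupling $c>0$ are $$S_{A_{n+1}}[w]=\frac{2}{c}\sum_{i=1}^{n-1}(w_i-w_{i+1})^2,\qquad S_{\mathbb{Z}_n}[w]=\frac{2}{c}\sum_{i=1}^{n}w_i(w_i-w_{i-1}),$$ with indices mod $n$ for $\mathbb{Z}_n$. The moduli space of regular connections has coordinates $w\in\mathbb{R}_{>0}^n$ for $A_{n+1}$ and $(w,\theta)\in\mathbb{R}_{>0}^n\times U(1)$ for $\mathbb{Z}_n$, where $\theta$ is the phase around the circle. The zero mode $\sum_i w_i$ is regularised by a cutoff $L>0$, so that the expectation values of an observable $\mathcal{O}$ are $$\langle\mathcal{O}\rangle_{A_{n+1}}=\frac{\int_{D_L}\mathcal{O}\,e^{-S_{A_{n+1}}[w]}\,\mathrm{d}^nw}{\int_{D_L}e^{-S_{A_{n+1}}[w]}\,\mathrm{d}^nw},\qquad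 \langle\mathcal{O}\rangle_{\mathbb{Z}_n}=\frac{\int_0^{2\pi}\mathrm{d}\theta\int_{D_L}\mathcal{O}\,e^{-S_{\mathbb{Z}_n}[w]}\,\mathrm{d}^nw}{\int_0^{2\pi}\mathrm{d}\theta\int_{D_L}e^{-S_{\mathbb{Z}_n}[w]}\,\mathrm{d}^nw},$$ where $D_L=\{w\in\mathbb{R}_{>0}^n:\sum_i w_i\le L\}$. Let $c_R=c/(2L^2)$ and let $w_{R,i}=w_i/L$ be the rescaled Wilson loop variables. Then, as $c_R\to\infty$, $$\langle w_{R,1}^{m_1}\cdots w_{R,n}^{m_n}\rangle_{A_{n+1}}=\binom{n+M}{m_1,\dots,m_n,n}^{-1}\left(1+\frac{1}{c_R}\left(2(n-1)\frac{n!}{(n+2)!}-C_1^{A_{n+1}}\right)\right)+O(c_R^{-2}),$$ and, if $n\ge2$, $$\langle w_{R,1}^{m_1}\cdots w_{R,n}^{m_n}\rangle_{\mathbb{Z}_n}=\binom{n+M}{m_1,\dots,m_n,n}^{-1}\left(1+\frac{1}{c_R}\left(n\,\frac{n!}{(n+2)!}-C_1^{\mathbb{Z}_n}\right)\right)+O(c_R^{-2}),$$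 where $$C_1^{A_{n+1}}=\frac{(n+M)!}{(n+M+2)!}\left(2(n-1+M)-m_1-m_n+\sum_{i=1}^{n-1}(m_i-m_{i+1})^2\right),$$ $$C_1^{\mathbb{Z}_n}=\frac{(n+M)!}{(n+M+2)!}\left(n+M+\sum_{i=1}^{n}m_i(m_i-m_{i-1})\right),$$ with $m_0=m_n$, and the constants in $O(c_R^{-2})$ depend only on $n$ and $m_1,\dots,m_n$ (not on $c$ or $L$ separately). -/

import Mathlib

open scoped BigOperators Nat

noncomputable section

namespace GraphGauge

/-- A connection of `ℂℤ₂`-gauge theory (in the nontrivial representation, where it is described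
by complex numbers) on a graph with `n` undirected edges that are arranged along a line or around a
circle. The edge `i` joins two consecutive vertices; `fwd i` and `bwd i` are the extended holonomies
`u_{i → i+1}` and `u_{i+1 → i}` along its two arrows, and unitarity of the connection says that they
are conjugate. (For the open line `A_{n+1}` the vertices are `0, …, n`; for the circle `ℤ_n` they
are taken modulo `n`.) -/
structure Connection (n : ℕ) where
  fwd : Fin n → ℂ
  bwd : Fin n → ℂ
  bwd_eq : ∀ i, bwd i = (starRingEnd ℂ) (fwd i)

/-- The Wilson loop variable `w_i = u_{i → i+1} u_{i+1 → i}` (the product is a real number). -/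
def wilsonLoop {n : ℕ} (u : Connection n) (i : Fin n) : ℝ := (u.fwd i * u.bwd i).re

/-- The Yang-Mills action of the open line `A_{n+1}`,
`(2/c) ∑_{i=1}^{n-1} (w_i - w_{i+1})²`. -/
def actionLine {n : ℕ} (c : ℝ) (u : Connection n) : ℝ :=
  (2 / c) * ∑ i : Fin n,
    if h : i.val + 1 < n then (wilsonLoop u i - wilsonLoop u ⟨i.val + 1, h⟩) ^ 2 else 0

/-- The Yang-Mills action of the circle `ℤ_n`, `(2/c) ∑_i w_i (w_i - w_{i-1})`, the index being
taken modulo `n` (subtraction in `Fin n` is cyclic). -/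
def actionCircle {n : ℕ} [NeZero n] (c : ℝ) (u : Connection n) : ℝ :=
  (2 / c) * ∑ i : Fin n, wilsonLoop u i * (wilsonLoop u i - wilsonLoop u (i - 1))

/-- The connection on the line with Wilson loop coordinates `w ∈ ℝ_{>0}^n` in the moduli space of
regular connections modulo gauge transformations: all phases can be gauged away. -/
def connLine {n : ℕ} (w : Fin n → ℝ) : Connection n where
  fwd i := (Real.sqrt (w i) : ℂ)
  bwd i := (starRingEnd ℂ) (Real.sqrt (w i) : ℂ)
  bwd_eq _ := rfl

/-- The connection on the circle with coordinates `(w, θ) ∈ ℝ_{>0}^n × U(1)` in the moduli space: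
all phases but that of the last edge can be gauged away. -/
def connCircle {n : ℕ} (w : Fin n → ℝ) (θ : ℝ) : Connection n where
  fwd i := Real.sqrt (w i) * (if i.val + 1 = n then Complex.exp (θ * Complex.I) else 1)
  bwd i := (starRingEnd ℂ)
    (Real.sqrt (w i) * (if i.val + 1 = n then Complex.exp (θ * Complex.I) else 1))
  bwd_eq _ := rfl

/-- The values of the Wilson loop variables that are allowed when the zero mode `∑ w_i` is cut off
at the scale `L`. -/
def cutoffRegion (n : ℕ) (L : ℝ) : Set (Fin n → ℝ) :=
  {w | (∀ i, 0 < w i) ∧ ∑ i, w i ∈ Set.Icc 0 L}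

/-- The functional integral of the observable `O` on `A_{n+1}`, weighted by `e^{-S}` and
regularised at the scale `L`. For `O = 1` it is the partition function. -/
def functionalIntegralLine {n : ℕ} (c L : ℝ) (O : Connection n → ℝ) : ℝ :=
  ∫ w in cutoffRegion n L, O (connLine w) * Real.exp (-actionLine c (connLine w))

/-- The functional integral of the observable `O` on `ℤ_n`, weighted by `e^{-S}` and
regularised at the scale `L`. For `O = 1` it is the partition function. -/
def functionalIntegralCircle {n : ℕ} [NeZero n] (c L : ℝ) (O : Connection n → ℝ) : ℝ :=
  ∫ θ in (0 : ℝ)..(2 * Real.pi), ∫ w in cutoffRegion n L,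
    O (connCircle w θ) * Real.exp (-actionCircle c (connCircle w θ))

/-- The expectation value of `O` on `A_{n+1}`. -/
def expectationLine {n : ℕ} (c L : ℝ) (O : Connection n → ℝ) : ℝ :=
  functionalIntegralLine c L O / functionalIntegralLine c L (fun _ : Connection n => 1)

/-- The expectation value of `O` on `ℤ_n`. -/
def expectationCircle {n : ℕ} [NeZero n] (c L : ℝ) (O : Connection n → ℝ) : ℝ :=
  functionalIntegralCircle c L O / functionalIntegralCircle c L (fun _ : Connection n => 1)

/-- The monomial `∏ (w_i / L)^{m_i}` in the rescaled Wilson loop variables. -/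
def wilsonMonomial {n : ℕ} (L : ℝ) (m : Fin n → ℕ) (u : Connection n) : ℝ :=
  ∏ i, (wilsonLoop u i / L) ^ m i

/-- The rescaled coupling `c_R = c / (2 L²)`. -/
def rescaledCoupling (c L : ℝ) : ℝ := c / (2 * L ^ 2)

/-- The multinomial coefficient `(n + M)! / (m_1! ⋯ m_n! n!)`, `M = ∑ m_i`. -/
def loopMultinomial {n : ℕ} (m : Fin n → ℕ) : ℕ :=
  Nat.multinomial Finset.univ (Fin.snoc m n : Fin (n + 1) → ℕ)

/-- The first order coefficient `C₁` of the line `A_{n+1}`. -/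
def C₁Line {n : ℕ} [NeZero n] (m : Fin n → ℕ) : ℝ :=
  ((n + ∑ i, m i)! : ℝ) / ((n + ∑ i, m i + 2)! : ℝ) *
    (2 * ((n : ℝ) - 1 + ∑ i, (m i : ℝ))
      - m 0 - m ⟨n - 1, Nat.sub_one_lt (NeZero.ne n)⟩
      + ∑ i : Fin n, if h : i.val + 1 < n then ((m i : ℝ) - m ⟨i.val + 1, h⟩) ^ 2 else 0)

/-- The first order coefficient `C₁` of the circle `ℤ_n` (indices modulo `n`). -/
def C₁Circle {n : ℕ} [NeZero n] (m : Fin n → ℕ) : ℝ :=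
  ((n + ∑ i, m i)! : ℝ) / ((n + ∑ i, m i + 2)! : ℝ) *
    ((n : ℝ) + ∑ i, (m i : ℝ) + ∑ i : Fin n, (m i : ℝ) * ((m i : ℝ) - m (i - 1)))

end GraphGauge

end

namespace GraphGauge

open MeasureTheory Set
open scoped Pointwise

/-! Both actions are `2/c` times a quadratic form in the Wilson loops, and phases drop out of `w_i`.
Rescaling `w` by `L` turns an expectation value into a quotient of integrals over the unit simplex
with weight `e^{-e q}`, `e = 1/c_R`, the powers of `L` and the factor `2π` cancelling. Only `c_R`
survives, so the error constants are uniform in `c` and `L`.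

On the bounded simplex `e^{-e q} = 1 - e q + O(e²)` uniformly. If the integral of `w^m q` is `s m`
times that of `w^m`, the quotient is the ratio of moments times `1 + e (s 0 - s m) + O(e²)`.

Dirichlet's integral `∏ m_i! / (n+M)!` gives the rest: the ratio of moments is the inverse
multinomial, and raising two exponents by one evaluates each term of `q`, so that `s m` is `C₁`. -/

theorem smul_cutoffRegion_one {n : ℕ} {L : ℝ} (hL : 0 < L) :
    L • cutoffRegion n 1 = cutoffRegion n L := by
  ext w
  rw [Set.mem_smul_set_iff_inv_smul_mem₀ hL.ne']
  simp only [cutoffRegion, Set.mem_ofPred_eq, Pi.smul_apply, smul_eq_mul, Set.mem_Icc,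
    ← Finset.mul_sum]
  have hL' := inv_pos.2 hL
  refine and_congr (forall_congr' fun i => ?_) (and_congr ?_ ?_)
  · rw [mul_pos_iff_of_pos_left hL']
  · rw [mul_nonneg_iff_of_pos_left hL']
  · rw [inv_mul_le_iff₀ hL, mul_one]

theorem setIntegral_cutoffRegion {n : ℕ} {L : ℝ} (hL : 0 < L) (f : (Fin n → ℝ) → ℝ) :
    ∫ w in cutoffRegion n L, f w = L ^ n * ∫ w in cutoffRegion n 1, f (L • w) := by
  have h := Measure.setIntegral_comp_smul_of_pos volume f (cutoffRegion n 1) hL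
  rw [smul_cutoffRegion_one hL, Module.finrank_fintype_fun_eq_card, Fintype.card_fin,
    smul_eq_mul] at h
  rw [h, mul_inv_cancel_left₀ (pow_pos hL n).ne']

theorem measurableSet_cutoffRegion (n : ℕ) (L : ℝ) : MeasurableSet (cutoffRegion n L) := by
  refine MeasurableSet.inter (s₁ := {w : Fin n → ℝ | ∀ i, 0 < w i})
    (s₂ := {w | ∑ i, w i ∈ Set.Icc 0 L}) ?_ ?_
  · simp only [Set.ofPred_forall]
    exact MeasurableSet.iInter fun i => measurableSet_lt measurable_const (measurable_pi_apply i)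
  · exact (Finset.measurable_sum _ fun i _ => measurable_pi_apply i) measurableSet_Icc

theorem cutoffRegion_one_subset (n : ℕ) :
    cutoffRegion n 1 ⊆ Set.Icc (0 : Fin n → ℝ) 1 := fun _ hw =>
  ⟨fun i => (hw.1 i).le, fun i =>
    (Finset.single_le_sum (fun j _ => (hw.1 j).le) (Finset.mem_univ i)).trans hw.2.2⟩

theorem integrableOn_cutoffRegion {n : ℕ} {f : (Fin n → ℝ) → ℝ} (hf : Continuous f) :
    IntegrableOn f (cutoffRegion n 1) :=
  (hf.continuousOn.integrableOn_compact isCompact_Icc).mono_set (cutoffRegion_one_subset n)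

theorem volume_cutoffRegion_lt_top (n : ℕ) : volume (cutoffRegion n 1) < ⊤ :=
  (measure_mono (cutoffRegion_one_subset n)).trans_lt isCompact_Icc.measure_lt_top

/-! ### Dirichlet integrals and moments of the simplex -/

theorem integral_pow_mul_exp_neg (k : ℕ) :
    ∫ x in Set.Ioi (0 : ℝ), x ^ k * Real.exp (-x) = k ! := by
  rw [← Real.Gamma_nat_eq_factorial, Real.Gamma_eq_integral (by positivity)]
  refine setIntegral_congr_fun measurableSet_Ioi fun x _ => ?_
  simp [mul_comm]

theorem integrableOn_pow_mul_exp_neg (k : ℕ) :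
    IntegrableOn (fun x : ℝ => x ^ k * Real.exp (-x)) (Set.Ioi 0) :=
  -- A non-integrable function has Bochner integral zero by convention.
  Integrable.of_integral_ne_zero (by
    rw [integral_pow_mul_exp_neg]; exact_mod_cast (Nat.factorial_pos k).ne')

/-- Dirichlet's integral over the standard simplex. -/
theorem integral_cutoffRegion_monomial {n : ℕ} [NeZero n] (m : Fin n → ℕ) :
    ∫ w in cutoffRegion n 1, ∏ i, w i ^ m i =
      (∏ i, ((m i)! : ℝ)) / ((n + ∑ i, m i)! : ℝ) := by
  set S : Set (Fin n → ℝ) := Set.univ.pi fun _ => Set.Ioi 0 with hS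
  have hSm : MeasurableSet S := MeasurableSet.univ_pi fun _ => measurableSet_Ioi
  have hμ : (volume : Measure (Fin n → ℝ)).restrict S
      = Measure.pi fun _ => (volume : Measure ℝ).restrict (Set.Ioi 0) := by
    rw [volume_pi, hS, Measure.restrict_pi_pi]
  -- Since `e^{-∑ w_i}` is the integral of `e^{-t}` over `t ≥ ∑ w_i`, the product of Gamma integrals
  -- becomes a double integral of `g`, to be evaluated in both orders.
  set g : (Fin n → ℝ) → ℝ → ℝ := fun w t =>
    {p : (Fin n → ℝ) × ℝ | ∑ i, p.1 i ≤ p.2}.indicator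
      (fun p => (∏ i, p.1 i ^ m i) * Real.exp (-p.2)) (w, t) with hg
  have hgm : Measurable (Function.uncurry g) := by
    refine Measurable.indicator ?_ ?_
    · fun_prop
    · exact measurableSet_le (by fun_prop) (by fun_prop)
  have hgt : ∀ w ∈ S, ∀ t, g w t =
      (Set.Ici (∑ i, w i)).indicator (fun t => (∏ i, w i ^ m i) * Real.exp (-t)) t := by
    intro w _ t
    simp only [hg, Set.indicator, Set.mem_ofPred_eq, Set.mem_Ici]
  have hsub : ∀ w ∈ S, Set.Ici (∑ i, w i) ⊆ Set.Ioi 0 := fun w hw t ht =>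
    Set.mem_Ioi.2 <| lt_of_lt_of_le (Finset.sum_pos (fun i _ => hw i (Set.mem_univ i))
      Finset.univ_nonempty) (Set.mem_Ici.1 ht)
  have hg0 : ∀ w ∈ S, ∀ t, 0 ≤ g w t := fun w hw t => by
    rw [hgt w hw]
    exact Set.indicator_nonneg (fun t _ => mul_nonneg
      (Finset.prod_nonneg fun i _ => pow_nonneg (hw i (Set.mem_univ i)).le _)
      (Real.exp_pos _).le) t
  have hint : ∀ w ∈ S, ∫ t in Set.Ioi 0, g w t = ∏ i, (w i ^ m i * Real.exp (-w i)) := by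
    intro w hw
    simp_rw [hgt w hw]
    rw [setIntegral_indicator measurableSet_Ici, Set.inter_eq_self_of_subset_right (hsub w hw),
      integral_const_mul, integral_Ici_eq_integral_Ioi, integral_exp_neg_Ioi,
      Finset.prod_mul_distrib, ← Real.exp_sum, Finset.sum_neg_distrib]
  have hae : ∀ᵐ w ∂(volume : Measure (Fin n → ℝ)).restrict S, w ∈ S := ae_restrict_mem hSm
  have hprod : ∫ w in S, ∏ i, (w i ^ m i * Real.exp (-w i)) = ∏ i, ((m i)! : ℝ) := by
    rw [hμ, integral_fintype_prod_eq_prod (fun i (x : ℝ) => x ^ m i * Real.exp (-x))]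
    simp_rw [integral_pow_mul_exp_neg]
  have hgi : Integrable (Function.uncurry g)
      ((volume.restrict S).prod (volume.restrict (Set.Ioi 0))) := by
    rw [integrable_prod_iff hgm.aestronglyMeasurable]
    constructor
    · filter_upwards [hae] with w hw
      have : (fun t => Function.uncurry g (w, t)) = (Set.Ici (∑ i, w i)).indicator
          (fun t => (∏ i, w i ^ m i) * Real.exp (-t)) := funext (hgt w hw)
      rw [this, integrable_indicator_iff measurableSet_Ici]
      refine Integrable.const_mul ?_ _
      rw [Measure.restrict_restrict measurableSet_Ici,
        Set.inter_eq_self_of_subset_left (hsub w hw)]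
      have h0 : IntegrableOn (fun t : ℝ => Real.exp (-t)) (Set.Ioi 0) := by
        simpa using integrableOn_pow_mul_exp_neg 0
      exact h0.mono_set (hsub w hw)
    · have h1 : Integrable (fun w : Fin n → ℝ => ∏ i, (w i ^ m i * Real.exp (-w i)))
          (volume.restrict S) := by
        rw [hμ]
        exact Integrable.fintype_prod (f := fun i (x : ℝ) => x ^ m i * Real.exp (-x))
          fun i => integrableOn_pow_mul_exp_neg (m i)
      refine h1.congr ?_
      filter_upwards [hae] with w hw
      rw [← hint w hw]
      refine integral_congr_ae (Filter.Eventually.of_forall fun t => ?_)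
      exact (Real.norm_of_nonneg (hg0 w hw t)).symm
  have hswap := integral_integral_swap hgi
  rw [setIntegral_congr_fun hSm hint, hprod] at hswap
  -- At fixed `t` the domain is the unit simplex scaled by `t`: the volume gives `t^n`, the monomial
  -- `t^M`. The `t`-integral is then `(n+M)!`.
  have hinner : ∀ t ∈ Set.Ioi (0 : ℝ), ∫ w in S, g w t =
      (t ^ (n + ∑ i, m i) * Real.exp (-t)) * ∫ w in cutoffRegion n 1, ∏ i, w i ^ m i := by
    intro t ht
    have h1 : ∀ w, g w t = {w : Fin n → ℝ | ∑ i, w i ≤ t}.indicator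
        (fun w => (∏ i, w i ^ m i) * Real.exp (-t)) w := fun w => rfl
    have h2 : S ∩ {w : Fin n → ℝ | ∑ i, w i ≤ t} = cutoffRegion n t := by
      ext w
      simp only [hS, Set.mem_inter_iff, Set.mem_univ_pi, Set.mem_Ioi, Set.mem_ofPred_eq,
        cutoffRegion, Set.mem_Icc]
      exact and_congr_right fun h =>
        ⟨fun h' => ⟨Finset.sum_nonneg fun i _ => (h i).le, h'⟩, fun h' => h'.2⟩
    simp_rw [h1]
    rw [setIntegral_indicator (measurableSet_le (by fun_prop) measurable_const), h2,
      integral_mul_const, setIntegral_cutoffRegion ht]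
    simp_rw [Pi.smul_apply, smul_eq_mul, mul_pow, Finset.prod_mul_distrib]
    rw [integral_const_mul, Finset.prod_pow_eq_pow_sum, pow_add]
    ring
  rw [setIntegral_congr_fun measurableSet_Ioi hinner, integral_mul_const,
    integral_pow_mul_exp_neg] at hswap
  rw [hswap, mul_div_cancel_left₀]
  exact_mod_cast (Nat.factorial_pos _).ne'

/-- The moment of the monomial with exponents `m` over the standard simplex. -/
noncomputable def simplexMoment {n : ℕ} (m : Fin n → ℕ) : ℝ :=
  ∫ w in cutoffRegion n 1, ∏ i, w i ^ m i

theorem simplexMoment_pos {n : ℕ} [NeZero n] (m : Fin n → ℕ) : 0 < simplexMoment m := by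
  rw [simplexMoment, integral_cutoffRegion_monomial]
  have : ∀ k : ℕ, (0 : ℝ) < k ! := fun k => by exact_mod_cast Nat.factorial_pos k
  exact div_pos (Finset.prod_pos fun i _ => this _) (this _)

theorem simplexMoment_add_single {n : ℕ} [NeZero n] (m : Fin n → ℕ) (i : Fin n) :
    simplexMoment (m + Pi.single i 1 : Fin n → ℕ) =
      simplexMoment m * ((m i + 1) / (n + ∑ j, (m j : ℝ) + 1)) := by
  have hsum : ∑ j, (m + Pi.single i 1 : Fin n → ℕ) j = ∑ j, m j + 1 := by
    simp [Finset.sum_add_distrib]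
  have hprod : ∏ j, ((((m + Pi.single i 1 : Fin n → ℕ) j)! : ℕ) : ℝ) = (m i + 1) * ∏ j, ((m j)! : ℝ) := by
    rw [← Finset.mul_prod_erase _ _ (Finset.mem_univ i),
      ← Finset.mul_prod_erase _ (fun j => ((m j)! : ℝ)) (Finset.mem_univ i), ← mul_assoc]
    congr 1
    · simp [Nat.factorial_succ]
    · refine Finset.prod_congr rfl fun j hj => ?_
      simp [Pi.single_eq_of_ne (Finset.ne_of_mem_erase hj)]
  rw [simplexMoment, simplexMoment, integral_cutoffRegion_monomial,
    integral_cutoffRegion_monomial, hsum, hprod, ← add_assoc, Nat.factorial_succ]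
  push_cast
  rw [div_mul_div_comm, mul_comm (∏ j, ((m j)! : ℝ)), mul_comm ((_ : ℝ) + 1) ((_ : ℕ) : ℝ)]

theorem prod_pow_mul {n : ℕ} (m : Fin n → ℕ) (w : Fin n → ℝ) (i : Fin n) :
    (∏ j, w j ^ m j) * w i = ∏ j, w j ^ (m + Pi.single i 1 : Fin n → ℕ) j := by
  simp_rw [Pi.add_apply, pow_add, Finset.prod_mul_distrib]
  congr 1
  rw [Finset.prod_eq_single i (fun j _ hj => by simp [Pi.single_eq_of_ne hj]) (by simp)]
  simp

/-- The exponents are raised one after the other; if `i = j`, the second step sees an exponent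
already increased, whence the extra `1`. -/
theorem integral_cutoffRegion_monomial_mul_mul {n : ℕ} [NeZero n] (m : Fin n → ℕ)
    (i j : Fin n) :
    ∫ w in cutoffRegion n 1, (∏ k, w k ^ m k) * (w i * w j) =
      simplexMoment m * ((m i + 1) * (m j + (if i = j then 1 else 0) + 1) /
        ((n + ∑ k, (m k : ℝ) + 1) * (n + ∑ k, (m k : ℝ) + 2))) := by
  simp_rw [← mul_assoc, prod_pow_mul]
  rw [← simplexMoment, simplexMoment_add_single, simplexMoment_add_single]
  have h1 : ∑ k, (((m + Pi.single i 1 : Fin n → ℕ) k : ℕ) : ℝ) = ∑ k, (m k : ℝ) + 1 := by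
    simp [Finset.sum_add_distrib, ← Nat.cast_sum]
  have h2 : (((m + Pi.single i 1 : Fin n → ℕ) j : ℕ) : ℝ) = m j + if i = j then 1 else 0 := by
    by_cases h : i = j
    · subst h; simp
    · simp [h]
  rw [h1, h2, mul_assoc, div_mul_div_comm]
  ring_nf

/-- The simplex volume `1/n!` supplies the additional entry `n` of the multinomial. -/
theorem simplexMoment_div_zero {n : ℕ} [NeZero n] (m : Fin n → ℕ) :
    simplexMoment m / simplexMoment (0 : Fin n → ℕ) = ((loopMultinomial m : ℝ))⁻¹ := by
  have h := Nat.multinomial_spec Finset.univ (Fin.snoc m n : Fin (n + 1) → ℕ)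
  rw [Fin.sum_snoc, Fin.prod_univ_castSucc] at h
  simp only [Fin.snoc_castSucc, Fin.snoc_last] at h
  change _ * loopMultinomial m = _ at h
  have h' : ((∏ i, ((m i)! : ℝ)) * (n ! : ℝ)) * (loopMultinomial m : ℝ) =
      ((n + ∑ i, m i)! : ℝ) := by
    rw [add_comm n, ← h]; push_cast; rfl
  have hn : (n ! : ℝ) ≠ 0 := by exact_mod_cast (Nat.factorial_pos _).ne'
  have hN : ((n + ∑ i, m i)! : ℝ) ≠ 0 := by exact_mod_cast (Nat.factorial_pos _).ne'
  have hl : (loopMultinomial m : ℝ) ≠ 0 := fun h0 => hN (by rw [← h', h0, mul_zero])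
  rw [simplexMoment, simplexMoment, integral_cutoffRegion_monomial,
    integral_cutoffRegion_monomial]
  simp only [Pi.zero_apply, Nat.factorial_zero, Nat.cast_one, Finset.prod_const_one,
    Finset.sum_const_zero, add_zero]
  rw [div_div_eq_mul_div, div_one, div_mul_eq_mul_div, inv_eq_one_div, div_eq_div_iff hN hl, h', one_mul]

/-! ### First order expansions with explicit remainders -/

/-- First order expansion of a Boltzmann weighted integral over the simplex. -/
theorem exists_abs_integral_mul_exp_sub_le {n : ℕ} {f q : (Fin n → ℝ) → ℝ}
    (hf : Continuous f) (hq : Continuous q) :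
    ∃ C ε : ℝ, 0 ≤ C ∧ 0 < ε ∧ ∀ e : ℝ, |e| ≤ ε →
      |(∫ w in cutoffRegion n 1, f w * Real.exp (-(e * q w)))
        - ((∫ w in cutoffRegion n 1, f w) - e * ∫ w in cutoffRegion n 1, f w * q w)|
        ≤ C * e ^ 2 := by
  obtain ⟨A, hA⟩ := (isCompact_Icc (a := (0 : Fin n → ℝ)) (b := 1)).exists_bound_of_continuousOn
    hf.continuousOn
  obtain ⟨B, hB⟩ := (isCompact_Icc (a := (0 : Fin n → ℝ)) (b := 1)).exists_bound_of_continuousOn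
    hq.continuousOn
  have hA0 : 0 ≤ A := (norm_nonneg _).trans (hA 0 ⟨le_rfl, zero_le_one⟩)
  have hB0 : 0 ≤ B := (norm_nonneg _).trans (hB 0 ⟨le_rfl, zero_le_one⟩)
  -- This range of `e` keeps `|e q| ≤ 1`, where `|exp x - 1 - x| ≤ x²`; `B + 1` avoids inverting
  -- zero.
  refine ⟨A * B ^ 2 * volume.real (cutoffRegion n 1), (B + 1)⁻¹, by positivity, by positivity,
    fun e he => ?_⟩
  have hi1 : IntegrableOn (fun w => f w * Real.exp (-(e * q w))) (cutoffRegion n 1) :=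
    integrableOn_cutoffRegion (by fun_prop)
  have hi2 := integrableOn_cutoffRegion (n := n) hf
  have hi3 : IntegrableOn (fun w => e * (f w * q w)) (cutoffRegion n 1) :=
    integrableOn_cutoffRegion (by fun_prop)
  have hi4 : IntegrableOn (fun w => f w - e * (f w * q w)) (cutoffRegion n 1) := hi2.sub hi3
  rw [← integral_const_mul, ← integral_sub hi2 hi3, ← integral_sub hi1 hi4]
  have hbound : ∀ w ∈ cutoffRegion n 1,
      ‖f w * Real.exp (-(e * q w)) - (f w - e * (f w * q w))‖ ≤ A * B ^ 2 * e ^ 2 := by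
    intro w hw
    have hw' := cutoffRegion_one_subset n hw
    have hqB : |q w| ≤ B := hB w hw'
    have hx : |-(e * q w)| ≤ 1 := by
      rw [abs_neg, abs_mul]
      calc |e| * |q w| ≤ (B + 1)⁻¹ * (B + 1) := by gcongr; linarith
        _ = 1 := inv_mul_cancel₀ (by positivity)
    have h1 := Real.abs_exp_sub_one_sub_id_le hx
    have h2 : f w * Real.exp (-(e * q w)) - (f w - e * (f w * q w)) =
        f w * (Real.exp (-(e * q w)) - 1 - -(e * q w)) := by ring
    rw [h2, norm_mul, mul_assoc]
    refine mul_le_mul (hA w hw') (h1.trans ?_) (norm_nonneg _) hA0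
    rw [neg_sq, mul_pow, mul_comm]
    exact mul_le_mul_of_nonneg_right (sq_le_sq' (abs_le.1 hqB).1 (abs_le.1 hqB).2) (sq_nonneg e)
  refine (norm_setIntegral_le_of_norm_le_const (volume_cutoffRegion_lt_top n) hbound).trans_eq ?_
  ring

/-- First order expansion of a quotient of two functions with known first order expansions. -/
theorem exists_abs_div_sub_le {N D : ℝ → ℝ} {a b a₀ b₀ C C₀ ε ε₀ : ℝ} (ha₀ : 0 < a₀)
    (hC : 0 ≤ C) (hC₀ : 0 ≤ C₀) (hε : 0 < ε) (hε₀ : 0 < ε₀)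
    (hN : ∀ e, |e| ≤ ε → |N e - (a - e * b)| ≤ C * e ^ 2)
    (hD : ∀ e, |e| ≤ ε₀ → |D e - (a₀ - e * b₀)| ≤ C₀ * e ^ 2) :
    ∃ K δ : ℝ, 0 < δ ∧ ∀ e, |e| ≤ δ →
      |N e / D e - (a / a₀ + e * (a / a₀ * (b₀ / a₀) - b / a₀))| ≤ K * e ^ 2 := by
  set p := a / a₀ * (b₀ / a₀) - b / a₀ with hp
  -- The bound `1` gives `e² ≤ |e|`; with it the last entry forces `D e ≥ a₀ / 2`.
  set δ := min (min ε ε₀) (min 1 (a₀ / (2 * (|b₀| + C₀ + 1)))) with hδ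
  have hδ0 : 0 < δ := by positivity
  refine ⟨2 / a₀ * (C + C₀ * (|a / a₀| + |p|) + |b₀ * p|), δ, hδ0, fun e he => ?_⟩
  have he1 : |e| ≤ 1 := he.trans ((min_le_right _ _).trans (min_le_left _ _))
  have heN := hN e (he.trans ((min_le_left _ _).trans (min_le_left _ _)))
  have heD := hD e (he.trans ((min_le_left _ _).trans (min_le_right _ _)))
  have he2 : |e| * (|b₀| + C₀ + 1) ≤ a₀ / 2 := by
    have h := he.trans ((min_le_right _ _).trans (min_le_right _ _))
    rw [le_div_iff₀ (by positivity)] at h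
    linarith
  have hsq : e ^ 2 ≤ |e| := by
    rw [← sq_abs]; nlinarith [abs_nonneg e]
  have hDpos : a₀ / 2 ≤ D e := by
    have h1 := (abs_le.1 heD).1
    have h2 : e * b₀ ≤ |e| * |b₀| := by rw [← abs_mul]; exact le_abs_self _
    have h3 : C₀ * e ^ 2 ≤ C₀ * |e| := mul_le_mul_of_nonneg_left hsq hC₀
    nlinarith [abs_nonneg e]
  have hD0 : 0 < D e := lt_of_lt_of_le (by positivity) hDpos
  -- The choice of `p` cancels the terms of order zero and one.
  have hkey : N e - D e * (a / a₀ + e * p) =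
      (N e - (a - e * b)) - (D e - (a₀ - e * b₀)) * (a / a₀ + e * p) + e ^ 2 * (b₀ * p) := by
    rw [hp]; field_simp; ring
  have hP : |a / a₀ + e * p| ≤ |a / a₀| + |p| := by
    refine (abs_add_le _ _).trans ?_
    rw [abs_mul]
    gcongr
    exact mul_le_of_le_one_left (abs_nonneg _) he1
  have hnum : |N e - D e * (a / a₀ + e * p)| ≤
      (C + C₀ * (|a / a₀| + |p|) + |b₀ * p|) * e ^ 2 := by
    rw [hkey]
    refine (abs_add_le _ _).trans ?_
    have h1 := abs_sub (N e - (a - e * b)) ((D e - (a₀ - e * b₀)) * (a / a₀ + e * p))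
    have h2 : |(D e - (a₀ - e * b₀)) * (a / a₀ + e * p)| ≤ C₀ * e ^ 2 * (|a / a₀| + |p|) := by
      rw [abs_mul]
      exact mul_le_mul heD hP (abs_nonneg _) (by positivity)
    have h3 : |e ^ 2 * (b₀ * p)| = e ^ 2 * |b₀ * p| := by
      rw [abs_mul, abs_of_nonneg (sq_nonneg e)]
    nlinarith
  have hdiv : N e / D e - (a / a₀ + e * p) = (N e - D e * (a / a₀ + e * p)) / D e := by
    field_simp
  rw [hdiv, abs_div, abs_of_pos hD0, div_le_iff₀ hD0]
  refine hnum.trans ?_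
  have hnn : 0 ≤ (C + C₀ * (|a / a₀| + |p|) + |b₀ * p|) * e ^ 2 := by positivity
  calc _ = (2 / a₀ * (C + C₀ * (|a / a₀| + |p|) + |b₀ * p|) * e ^ 2) * (a₀ / 2) := by
        field_simp
    _ ≤ _ := mul_le_mul_of_nonneg_left hDpos (by positivity)

/-! ### Reduction of expectation values to weighted moments of the simplex -/

theorem wilsonLoop_connLine {n : ℕ} {w : Fin n → ℝ} (hw : ∀ i, 0 < w i) (i : Fin n) :
    wilsonLoop (connLine w) i = w i := by
  simp only [wilsonLoop, connLine, Complex.mul_conj, Complex.normSq_ofReal, Complex.ofReal_re]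
  exact Real.mul_self_sqrt (hw i).le

theorem wilsonLoop_connCircle {n : ℕ} {w : Fin n → ℝ} (hw : ∀ i, 0 < w i) (θ : ℝ) (i : Fin n) :
    wilsonLoop (connCircle w θ) i = w i := by
  simp only [wilsonLoop, connCircle, Complex.mul_conj, Complex.ofReal_re, Complex.normSq_mul,
    Complex.normSq_ofReal]
  rw [Real.mul_self_sqrt (hw i).le]
  split_ifs
  · rw [Complex.normSq_eq_norm_sq, Complex.norm_exp_ofReal_mul_I, one_pow, mul_one]
  · rw [map_one, mul_one]

/-- The quadratic form in the action of the open line. -/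
def lineForm {n : ℕ} (w : Fin n → ℝ) : ℝ :=
  ∑ i : Fin n, if h : i.val + 1 < n then (w i - w ⟨i.val + 1, h⟩) ^ 2 else 0

/-- The quadratic form in the action of the circle. -/
def circleForm {n : ℕ} [NeZero n] (w : Fin n → ℝ) : ℝ :=
  ∑ i : Fin n, w i * (w i - w (i - 1))

theorem lineForm_smul {n : ℕ} (L : ℝ) (w : Fin n → ℝ) :
    lineForm (L • w) = L ^ 2 * lineForm w := by
  rw [lineForm, lineForm, Finset.mul_sum]
  refine Finset.sum_congr rfl fun i _ => ?_
  split_ifs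
  · simp only [Pi.smul_apply, smul_eq_mul]; ring
  · rw [mul_zero]

theorem circleForm_smul {n : ℕ} [NeZero n] (L : ℝ) (w : Fin n → ℝ) :
    circleForm (L • w) = L ^ 2 * circleForm w := by
  rw [circleForm, circleForm, Finset.mul_sum]
  refine Finset.sum_congr rfl fun i _ => ?_
  simp only [Pi.smul_apply, smul_eq_mul]; ring

theorem continuous_lineForm {n : ℕ} : Continuous (lineForm : (Fin n → ℝ) → ℝ) := by
  refine continuous_finsetSum _ fun i _ => ?_
  split_ifs
  · fun_prop
  · exact continuous_const

theorem continuous_circleForm {n : ℕ} [NeZero n] :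
    Continuous (circleForm : (Fin n → ℝ) → ℝ) := by
  unfold circleForm
  fun_prop

/-- The integral of a monomial over the standard simplex, weighted by `e^{-e q}`. -/
noncomputable def weightedMoment {n : ℕ} (q : (Fin n → ℝ) → ℝ) (m : Fin n → ℕ) (e : ℝ) : ℝ :=
  ∫ w in cutoffRegion n 1, (∏ i, w i ^ m i) * Real.exp (-(e * q w))

/-- Homogeneity of degree two turns `2/c` into `2 L²/c = 1/c_R`. -/
theorem setIntegral_cutoffRegion_rescale {n : ℕ} {c L : ℝ} (hL : 0 < L)
    {q : (Fin n → ℝ) → ℝ} (hq : ∀ w, q (L • w) = L ^ 2 * q w) (m : Fin n → ℕ) :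
    ∫ w in cutoffRegion n L, (∏ i, (w i / L) ^ m i) * Real.exp (-(2 / c * q w)) =
      L ^ n * weightedMoment q m (1 / rescaledCoupling c L) := by
  rw [setIntegral_cutoffRegion hL, weightedMoment]
  congr 2 with w
  simp only [hq, Pi.smul_apply, smul_eq_mul, mul_div_cancel_left₀ _ hL.ne', rescaledCoupling]
  rw [one_div_div]
  ring_nf

theorem functionalIntegralLine_wilsonMonomial {n : ℕ} (c : ℝ) {L : ℝ} (hL : 0 < L)
    (m : Fin n → ℕ) :
    functionalIntegralLine c L (wilsonMonomial L m) =
      L ^ n * weightedMoment lineForm m (1 / rescaledCoupling c L) := by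
  rw [← setIntegral_cutoffRegion_rescale hL (lineForm_smul L), functionalIntegralLine]
  refine setIntegral_congr_fun (measurableSet_cutoffRegion n L) fun w hw => ?_
  simp only [wilsonMonomial, actionLine, wilsonLoop_connLine hw.1, lineForm]

theorem functionalIntegralCircle_wilsonMonomial {n : ℕ} [NeZero n] (c : ℝ) {L : ℝ} (hL : 0 < L)
    (m : Fin n → ℕ) :
    functionalIntegralCircle c L (wilsonMonomial L m) =
      2 * Real.pi * L ^ n * weightedMoment circleForm m (1 / rescaledCoupling c L) := by
  rw [mul_assoc, ← setIntegral_cutoffRegion_rescale hL (circleForm_smul L),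
    functionalIntegralCircle]
  have h : ∀ θ : ℝ, ∫ w in cutoffRegion n L, wilsonMonomial L m (connCircle w θ) *
      Real.exp (-actionCircle c (connCircle w θ)) =
      ∫ w in cutoffRegion n L, (∏ i, (w i / L) ^ m i) * Real.exp (-(2 / c * circleForm w)) :=
    fun θ => setIntegral_congr_fun (measurableSet_cutoffRegion n L) fun w hw => by
      simp only [wilsonMonomial, actionCircle, wilsonLoop_connCircle hw.1, circleForm]
  simp_rw [h]
  rw [intervalIntegral.integral_const, sub_zero, smul_eq_mul]

/-- Makes the partition function the case `m = 0` of the numerator. -/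
theorem wilsonMonomial_zero {n : ℕ} (L : ℝ) :
    wilsonMonomial L (0 : Fin n → ℕ) = fun _ => 1 := by
  ext u
  simp [wilsonMonomial]

theorem expectationLine_wilsonMonomial {n : ℕ} (c : ℝ) {L : ℝ} (hL : 0 < L)
    (m : Fin n → ℕ) :
    expectationLine c L (wilsonMonomial L m) =
      weightedMoment lineForm m (1 / rescaledCoupling c L) /
        weightedMoment lineForm (0 : Fin n → ℕ) (1 / rescaledCoupling c L) := by
  rw [expectationLine, ← wilsonMonomial_zero L, functionalIntegralLine_wilsonMonomial c hL,
    functionalIntegralLine_wilsonMonomial c hL, mul_div_mul_left _ _ (pow_pos hL n).ne']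

theorem expectationCircle_wilsonMonomial {n : ℕ} [NeZero n] (c : ℝ) {L : ℝ} (hL : 0 < L)
    (m : Fin n → ℕ) :
    expectationCircle c L (wilsonMonomial L m) =
      weightedMoment circleForm m (1 / rescaledCoupling c L) /
        weightedMoment circleForm (0 : Fin n → ℕ) (1 / rescaledCoupling c L) := by
  have h : 2 * Real.pi * L ^ n ≠ 0 := by positivity
  rw [expectationCircle, ← wilsonMonomial_zero L, functionalIntegralCircle_wilsonMonomial c hL,
    functionalIntegralCircle_wilsonMonomial c hL, mul_div_mul_left _ _ h]

/-- First order expansion of a weighted moment, normalised by the partition function. -/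
theorem exists_abs_weightedMoment_div_sub_le {n : ℕ} [NeZero n] {q : (Fin n → ℝ) → ℝ}
    (hq : Continuous q) {s : (Fin n → ℕ) → ℝ}
    (hs : ∀ m : Fin n → ℕ,
      ∫ w in cutoffRegion n 1, (∏ i, w i ^ m i) * q w = simplexMoment m * s m)
    (m : Fin n → ℕ) :
    ∃ K c₀ : ℝ, 0 < c₀ ∧ ∀ R : ℝ, c₀ ≤ R →
      |weightedMoment q m (1 / R) / weightedMoment q 0 (1 / R)
        - ((loopMultinomial m : ℝ))⁻¹ * (1 + 1 / R * (s 0 - s m))| ≤ K / R ^ 2 := by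
  have hc : ∀ m : Fin n → ℕ, Continuous fun w : Fin n → ℝ => ∏ i, w i ^ m i := fun m => by
    fun_prop
  obtain ⟨C, ε, hC, hε, hN⟩ := exists_abs_integral_mul_exp_sub_le (hc m) hq
  obtain ⟨C₀, ε₀, hC₀, hε₀, hD⟩ := exists_abs_integral_mul_exp_sub_le (hc 0) hq
  rw [hs] at hN hD
  obtain ⟨K, δ, hδ, h⟩ := exists_abs_div_sub_le (simplexMoment_pos (0 : Fin n → ℕ))
    hC hC₀ hε hε₀ hN hD
  refine ⟨K, δ⁻¹, inv_pos.2 hδ, fun R hR => ?_⟩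
  have hR0 : 0 < R := (inv_pos.2 hδ).trans_le hR
  have h1 := h (1 / R) (by
    rw [abs_of_pos (by positivity), one_div]
    exact inv_le_of_inv_le₀ hδ hR)
  have h0 := (simplexMoment_pos (0 : Fin n → ℕ)).ne'
  rw [one_div_pow, mul_one_div] at h1
  refine le_trans (le_of_eq ?_) h1
  rw [← simplexMoment_div_zero]
  simp only [weightedMoment, simplexMoment] at h0 ⊢
  congr 2
  field_simp

/-! ### First order coefficients of the line and the circle -/

theorem factorial_div_factorial_add_two (N : ℕ) :
    (N ! : ℝ) / ((N + 2)! : ℝ) = 1 / (((N : ℝ) + 1) * (N + 2)) := by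
  have : (N ! : ℝ) ≠ 0 := by exact_mod_cast (Nat.factorial_pos N).ne'
  rw [Nat.factorial_succ, Nat.factorial_succ]
  push_cast
  field_simp
  ring

theorem integrableOn_monomial_mul_mul {n : ℕ} (m : Fin n → ℕ) (i j : Fin n) :
    IntegrableOn (fun w : Fin n → ℝ => (∏ k, w k ^ m k) * (w i * w j)) (cutoffRegion n 1) :=
  integrableOn_cutoffRegion (by fun_prop)

theorem integral_monomial_mul_mul_sub {n : ℕ} [NeZero n] (m : Fin n → ℕ) {i j : Fin n}
    (hij : i ≠ j) :
    ∫ w in cutoffRegion n 1, (∏ k, w k ^ m k) * (w i * (w i - w j)) =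
      simplexMoment m * (((n + ∑ k, m k)! : ℝ) / ((n + ∑ k, m k + 2)! : ℝ) *
        ((m i : ℝ) * ((m i : ℝ) - m j) + 2 * m i - m j + 1)) := by
  have h : ∀ w : Fin n → ℝ, (∏ k, w k ^ m k) * (w i * (w i - w j)) =
      (∏ k, w k ^ m k) * (w i * w i) - (∏ k, w k ^ m k) * (w i * w j) := fun w => by ring
  simp_rw [h]
  rw [integral_sub (integrableOn_monomial_mul_mul m i i) (integrableOn_monomial_mul_mul m i j),
    integral_cutoffRegion_monomial_mul_mul,
    integral_cutoffRegion_monomial_mul_mul, factorial_div_factorial_add_two, if_pos rfl,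
    if_neg hij]
  push_cast
  ring

theorem integral_monomial_mul_sub_sq {n : ℕ} [NeZero n] (m : Fin n → ℕ) {i j : Fin n}
    (hij : i ≠ j) :
    ∫ w in cutoffRegion n 1, (∏ k, w k ^ m k) * (w i - w j) ^ 2 =
      simplexMoment m * (((n + ∑ k, m k)! : ℝ) / ((n + ∑ k, m k + 2)! : ℝ) *
        (((m i : ℝ) - m j) ^ 2 + m i + m j + 2)) := by
  -- A square is the sum of two terms of circle type, one for each order of the pair.
  have h : ∀ w : Fin n → ℝ, (∏ k, w k ^ m k) * (w i - w j) ^ 2 =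
      (∏ k, w k ^ m k) * (w i * (w i - w j)) + (∏ k, w k ^ m k) * (w j * (w j - w i)) :=
    fun w => by ring
  simp_rw [h]
  rw [integral_add (integrableOn_cutoffRegion (by fun_prop))
      (integrableOn_cutoffRegion (by fun_prop)),
    integral_monomial_mul_mul_sub m hij, integral_monomial_mul_mul_sub m hij.symm]
  ring

theorem sum_dite_add_one_lt {k : ℕ} (F : Fin (k + 1) → Fin (k + 1) → ℝ) :
    (∑ i : Fin (k + 1), if h : i.val + 1 < k + 1 then F i ⟨i.val + 1, h⟩ else 0) =
      ∑ i : Fin k, F i.castSucc i.succ := by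
  rw [Fin.sum_univ_castSucc, dif_neg (by simp), add_zero]
  refine Finset.sum_congr rfl fun i _ => ?_
  rw [dif_pos (by simp)]
  rfl

/-- Summing `m_i + m_{i+1} + 2` over adjacent pairs counts every edge twice except for the two ends,
whence `- m_1 - m_n`. -/
theorem integral_monomial_mul_lineForm {n : ℕ} [NeZero n] (m : Fin n → ℕ) :
    ∫ w in cutoffRegion n 1, (∏ k, w k ^ m k) * lineForm w = simplexMoment m * C₁Line m := by
  obtain ⟨k, rfl⟩ := Nat.exists_eq_succ_of_ne_zero (NeZero.ne n)
  have hF : ∀ w : Fin (k + 1) → ℝ, lineForm w = ∑ i : Fin k, (w i.castSucc - w i.succ) ^ 2 :=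
    fun w => sum_dite_add_one_lt fun i j => (w i - w j) ^ 2
  simp only [hF, Finset.mul_sum]
  rw [integral_finsetSum _ fun i _ => integrableOn_cutoffRegion (by fun_prop)]
  simp_rw [integral_monomial_mul_sub_sq m (Fin.castSucc_lt_succ).ne]
  rw [← Finset.mul_sum, ← Finset.mul_sum, C₁Line,
    sum_dite_add_one_lt fun i j => ((m i : ℝ) - m j) ^ 2]
  simp only [Finset.sum_add_distrib]
  have h0 := Fin.sum_univ_succ fun i => (m i : ℝ)
  have h1 := Fin.sum_univ_castSucc fun i => (m i : ℝ)
  have h2 : (⟨k.succ - 1, Nat.sub_one_lt (NeZero.ne _)⟩ : Fin (k + 1)) = Fin.last k := rfl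
  rw [h2]
  have h3 : (∑ i : Fin k, (m i.castSucc : ℝ)) = ∑ i, (m i : ℝ) - m (Fin.last k) := by
    rw [h1]; ring
  have h4 : (∑ i : Fin k, (m i.succ : ℝ)) = ∑ i, (m i : ℝ) - m 0 := by
    rw [h0]; ring
  rw [h3, h4]
  simp only [Finset.sum_const, Finset.card_univ, Fintype.card_fin, nsmul_eq_mul]
  push_cast
  ring

theorem integral_monomial_mul_circleForm {n : ℕ} [NeZero n] (hn : 2 ≤ n) (m : Fin n → ℕ) :
    ∫ w in cutoffRegion n 1, (∏ k, w k ^ m k) * circleForm w =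
      simplexMoment m * C₁Circle m := by
  -- For `n = 1` the cyclic predecessor of `i` is `i` itself and the formula for distinct indices
  -- would not apply.
  have hne : ∀ i : Fin n, i ≠ i - 1 := fun i h => by
    have h1 := congrArg Fin.val (sub_eq_self.1 h.symm)
    rw [Fin.val_one', Nat.mod_eq_of_lt hn] at h1
    exact one_ne_zero h1
  simp only [circleForm, Finset.mul_sum]
  rw [integral_finsetSum _ fun i _ => integrableOn_cutoffRegion (by fun_prop)]
  simp_rw [integral_monomial_mul_mul_sub m (hne _)]
  rw [← Finset.mul_sum, ← Finset.mul_sum, C₁Circle]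
  -- By cyclic invariance the linear terms `2 m_i - m_{i-1}` add up to `M`.
  have h : ∑ i, (m (i - 1) : ℝ) = ∑ i, (m i : ℝ) :=
    Equiv.sum_comp (Equiv.subRight (1 : Fin n)) fun i => (m i : ℝ)
  simp only [Finset.sum_add_distrib, Finset.sum_sub_distrib, ← Finset.mul_sum, h,
    Finset.sum_const, Finset.card_univ, Fintype.card_fin, nsmul_eq_mul, mul_one]
  ring

theorem C₁Line_zero {n : ℕ} [NeZero n] :
    C₁Line (0 : Fin n → ℕ) = 2 * ((n : ℝ) - 1) * ((n ! : ℝ) / ((n + 2)! : ℝ)) := by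
  simp [C₁Line, mul_comm]

theorem C₁Circle_zero {n : ℕ} [NeZero n] :
    C₁Circle (0 : Fin n → ℕ) = (n : ℝ) * ((n ! : ℝ) / ((n + 2)! : ℝ)) := by
  simp [C₁Circle, mul_comm]

end GraphGauge

theorem mainTheorem7 (n : ℕ) [NeZero n] (m : Fin n → ℕ) :
    (∃ K c₀ : ℝ, 0 < c₀ ∧ ∀ c L : ℝ, 0 < L → c₀ ≤ GraphGauge.rescaledCoupling c L →
      |GraphGauge.expectationLine c L (GraphGauge.wilsonMonomial L m)
        - ((GraphGauge.loopMultinomial m : ℝ))⁻¹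
          * (1 + 1 / GraphGauge.rescaledCoupling c L
              * (2 * ((n : ℝ) - 1) * ((n ! : ℝ) / ((n + 2)! : ℝ)) - GraphGauge.C₁Line m))|
        ≤ K / GraphGauge.rescaledCoupling c L ^ 2) ∧
    (2 ≤ n →
      ∃ K c₀ : ℝ, 0 < c₀ ∧ ∀ c L : ℝ, 0 < L → c₀ ≤ GraphGauge.rescaledCoupling c L →
        |GraphGauge.expectationCircle c L (GraphGauge.wilsonMonomial L m)
          - ((GraphGauge.loopMultinomial m : ℝ))⁻¹
            * (1 + 1 / GraphGauge.rescaledCoupling c L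
                * ((n : ℝ) * ((n ! : ℝ) / ((n + 2)! : ℝ)) - GraphGauge.C₁Circle m))|
          ≤ K / GraphGauge.rescaledCoupling c L ^ 2) := by
  refine ⟨?_, fun hn => ?_⟩
  · obtain ⟨K, c₀, hc₀, h⟩ := GraphGauge.exists_abs_weightedMoment_div_sub_le
      GraphGauge.continuous_lineForm GraphGauge.integral_monomial_mul_lineForm m
    refine ⟨K, c₀, hc₀, fun c L hL hc => ?_⟩
    rw [GraphGauge.expectationLine_wilsonMonomial c hL, ← GraphGauge.C₁Line_zero]
    exact h _ hc
  · obtain ⟨K, c₀, hc₀, h⟩ := GraphGauge.exists_abs_weightedMoment_div_sub_le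
      GraphGauge.continuous_circleForm (GraphGauge.integral_monomial_mul_circleForm hn) m
    refine ⟨K, c₀, hc₀, fun c L hL hc => ?_⟩
    rw [GraphGauge.expectationCircle_wilsonMonomial c hL, ← GraphGauge.C₁Circle_zero]
    exact h _ hc
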